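/- For each integer $n\ge 1$ let $\theta^{(n)}_1,\dots,\theta^{(n)}_n$ be random variables with values in $[0,2\pi)$, defined on a common probability space (which may depend on $n$); no independence or identical distribution is assumed. Set $$p_n(z):=\prod_{j=1}^n\bigl(z-e^{i\theta^{(n)}_j}\bigr).$$ Assume: (i) $\displaystyle \lim_{\delta\searrow 0}\limsup_{n\to\infty}\mathbb P\Bigl(\Bigl|\sum_{j=1}^n e^{-i\theta^{(n)}_j}\Bigr|\le\delta\Bigr)=0$; (ii) for (Lebesgue) almost every $z\in\mathbb D:=\{w\in\mathbb C:|w|<1\}$, $$\lim_{\delta\searrow 0}\limsup_{n\to\infty}\mathbb P\Bigl(\Bigl|\sum_{m=0}^{\lfloor\log^2 n\rfloor}z^m\sum_{j=1}^n e^{-i\theta^{(n)}_j(m+1)}\Bigr|\le\delta\Bigr)=0,$$ where $\log^2 n=(\log n)^2$; (iii) for every integer $m\ge 1$, $\displaystyle \frac1n\sum_{j=1}^n e^{i\theta^{(n)}_j m}\longrightarrow 0$ in probability as $n\to\infty$. For $n\ge2$ let $\mu'_{p_n}:=\frac{1}{n-1}\sum_{z:\,p_n'(z)=0}N_{p_n'}(z)\,\delta_z$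 be the empirical measure of the critical points of $p_n$, where $N_{p_n'}(z)$ is the multiplicity of $z$ as a root of $p_n'$. Then $\mu'_{p_n}$ converges weakly in probability, as $n\to\infty$, to the uniform probability distribution $\mu$ on the unit circle centered at the origin; that is, for every bounded continuous $f:\mathbb C\to\mathbb R$ and every $\varepsilon>0$, $$\lim_{n\to\infty}\mathbb P\Bigl(\Bigl|\int f\,d\mu'_{p_n}-\int f\,d\mu\Bigr|>\varepsilon\Bigr)=0.$$ -/

import Mathlib

open Filter Topology MeasureTheory Polynomial
open scoped ENNReal BoundedContinuousFunction

/-- The empirical measure `(1/n) ∑_{z : f(z) = 0} N_f(z) δ_z` of the roots of a complex polynomial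
`f` of degree `n`, where `N_f(z)` is the multiplicity of the root `z`. It is a probability measure
whenever `f` is non-constant, and the zero measure when `f` is constant. -/
noncomputable def rootMeasure (f : ℂ[X]) : Measure ℂ :=
  (f.natDegree : ℝ≥0∞)⁻¹ • ∑ z ∈ f.roots.toFinset, (f.rootMultiplicity z : ℝ≥0∞) • Measure.dirac z

/-- The empirical measure of the critical points of `f`, that is, of the roots of `f'`. -/
noncomputable def criticalMeasure (f : ℂ[X]) : Measure ℂ := rootMeasure (derivative f)

/-- The uniform probability distribution on the unit circle of `ℂ`: the law of `exp(i t)` for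
`t` uniform on `[0, 2π)`. -/
noncomputable def uniformCircle : Measure ℂ :=
  ((ENNReal.ofReal (2 * Real.pi))⁻¹ • volume.restrict (Set.Ico 0 (2 * Real.pi))).map
    (fun t : ℝ => Complex.exp (Complex.I * t))

/-- The polynomial `∏_j (z - exp(i θ_j))`. -/
noncomputable def circlePoly {n : ℕ} (θ : Fin n → ℝ) : ℂ[X] :=
  ∏ j, (X - C (Complex.exp (Complex.I * θ j)))

/-- Convergence in probability of complex random variables `Y n` to a constant `c`;
`Y n` may live on its own probability space `(Ω n, P n)`. -/
def TendstoInProb {Ω : ℕ → Type*} [∀ n, MeasurableSpace (Ω n)] (P : ∀ n, Measure (Ω n))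
    (Y : ∀ n, Ω n → ℂ) (c : ℂ) : Prop :=
  ∀ ε : ℝ, 0 < ε → Tendsto (fun n => P n {ω | ε < ‖Y n ω - c‖}) atTop (𝓝 0)

/-- Weak convergence in probability of random measures `μ n` to a deterministic measure `ν`:
for every bounded continuous real function `f`, the random variables `∫ f dμ_n` converge in
probability to `∫ f dν`. -/
def TendstoWeaklyInProb {T : Type*} [TopologicalSpace T] [MeasurableSpace T] [BorelSpace T]
    {Ω : ℕ → Type*} [∀ n, MeasurableSpace (Ω n)] (P : ∀ n, Measure (Ω n))
    (μ : ∀ n, Ω n → Measure T) (ν : Measure T) : Prop :=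
  ∀ (f : T →ᵇ ℝ) (ε : ℝ), 0 < ε →
    Tendsto (fun n => P n {ω | ε < |∫ x, f x ∂(μ n ω) - ∫ x, f x ∂ν|}) atTop (𝓝 0)

/-- Asymptotic anti-concentration at the origin:
`lim_{δ ↘ 0} limsup_{n → ∞} P(|Y_n| ≤ δ) = 0`. -/
def AntiConcentratesAtZero {Ω : ℕ → Type*} [∀ n, MeasurableSpace (Ω n)] (P : ∀ n, Measure (Ω n))
    (Y : ∀ n, Ω n → ℂ) : Prop :=
  Tendsto (fun δ : ℝ => limsup (fun n => P n {ω | ‖Y n ω‖ ≤ δ}) atTop) (𝓝[>] 0) (𝓝 0)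

/-! ### Power sums of the critical points of a polynomial -/

/-! The limit law is identified through its mixed moments. By Gauss–Lucas all critical points lie in
the closed unit disk, so Stone–Weierstrass (`exists_mixed_polynomial_approx`) reduces weak
convergence to convergence of the means of `z ^ a * conj z ^ b`. Two facts give these.

Radially, `|p'(0)| / |p(0)|` is both `|∑ e^{-iθ_j}|` and `n` times the product of the moduli of the
critical points (`norm_sum_exp_neg_eq`). By `h1` this is at least `δ` up to small probability, so
the mean of `1 - |z|²` is `O(log (n/δ) / n)`: the critical points approach the circle on average,
and `z * conj z` may be replaced by `1` in mixed moments.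

What remains is holomorphic moments, up to conjugation. The power sums of roots and critical points
satisfy an exact convolution recursion (`sum_antidiagonal_powerSum`), which bounds their difference
independently of the degree (`exists_norm_powerSum_sub_le`). After division by `n - 1`, `h3` sends
the moments of positive order to zero. -/

/-- The power sum `∑ w ∈ s, w ^ m` over a multiset. -/
noncomputable def powerSum (s : Multiset ℂ) (m : ℕ) : ℂ := (s.map (· ^ m)).sum

/-- The generating function of the power sums of a multiset. -/
noncomputable def powerSumSeries (s : Multiset ℂ) : PowerSeries ℂ := PowerSeries.mk (powerSum s)

/-- The power series `∏ w ∈ s, (1 - w X)`. -/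
noncomputable def reverseProd (s : Multiset ℂ) : PowerSeries ℂ :=
  (s.map fun w => 1 - PowerSeries.C w * PowerSeries.X).prod

/-- The monic polynomial `∏ w ∈ s, (X - w)`. -/
noncomputable def monicProd (s : Multiset ℂ) : ℂ[X] := (s.map fun w => X - C w).prod

theorem powerSum_zero (s : Multiset ℂ) : powerSum s 0 = Multiset.card s := by
  simp [powerSum]

theorem reverseProd_ne_zero (s : Multiset ℂ) : reverseProd s ≠ 0 := by
  intro h
  have := congrArg PowerSeries.constantCoeff h
  simp only [reverseProd, map_multiset_prod, Multiset.map_map] at this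
  simp at this

theorem reverse_X_sub_C_eq (w : ℂ) : (X - C w : ℂ[X]).reverse = 1 - C w * X := by
  ext m
  rw [coeff_reverse, natDegree_X_sub_C]
  rcases m with _ | _ | m
  · simp [revAt_le]
  · simp [revAt_le, coeff_one]
  · rw [revAt_eq_self_of_lt (by omega)]
    simp [coeff_X, coeff_one]

theorem coe_reverse_monicProd (s : Multiset ℂ) :
    ((monicProd s).reverse : PowerSeries ℂ) = reverseProd s := by
  induction s using Multiset.induction with
  | empty => simpa [monicProd, reverseProd] using congrArg Polynomial.toPowerSeries (reverse_C (1 : ℂ))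
  | cons w s ih =>
    simp only [monicProd, reverseProd, Multiset.map_cons, Multiset.prod_cons] at ih ⊢
    rw [reverse_mul_of_domain, Polynomial.coe_mul, ih, reverse_X_sub_C_eq]
    simp

theorem natDegree_monicProd (s : Multiset ℂ) : (monicProd s).natDegree = Multiset.card s :=
  natDegree_multiset_prod_X_sub_C_eq_card s

theorem coeff_reverseProd (s : Multiset ℂ) (m : ℕ) :
    PowerSeries.coeff m (reverseProd s) =
      if m ≤ Multiset.card s then (monicProd s).coeff (Multiset.card s - m) else 0 := by
  rw [← coe_reverse_monicProd, Polynomial.coeff_coe, coeff_reverse, natDegree_monicProd]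
  split_ifs with h
  · rw [revAt_le h]
  · rw [revAt_eq_self_of_lt (by omega), coeff_eq_zero_of_natDegree_lt]
    rw [natDegree_monicProd]; omega

/-- Logarithmic derivative of a product: each factor `1 - wX` contributes `-wX / (1 - wX)`, which is
one minus a geometric series. -/
theorem X_mul_derivative_reverseProd (s : Multiset ℂ) :
    PowerSeries.X * PowerSeries.derivative ℂ (reverseProd s) =
      ((Multiset.card s : PowerSeries ℂ) - powerSumSeries s) * reverseProd s := by
  induction s using Multiset.induction with
  | empty =>
    have : powerSumSeries 0 = 0 := by ext; simp [powerSumSeries, powerSum]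
    simp [reverseProd, this]
  | cons w s ih =>
    have hgeom : (1 - PowerSeries.C w * PowerSeries.X) * PowerSeries.mk (fun m => w ^ m) = 1 := by
      ext m
      rcases m with _ | m
      · simp
      · simp [sub_mul, mul_assoc, PowerSeries.coeff_succ_X_mul, PowerSeries.coeff_one, pow_succ']
    have hA : powerSumSeries (w ::ₘ s) = PowerSeries.mk (fun m => w ^ m) + powerSumSeries s := by
      ext m; simp [powerSumSeries, powerSum]
    have hP : reverseProd (w ::ₘ s) =
        (1 - PowerSeries.C w * PowerSeries.X) * reverseProd s := by
      simp [reverseProd]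
    have hD : PowerSeries.derivative ℂ (1 - PowerSeries.C w * PowerSeries.X) =
        -PowerSeries.C w := by
      simp
    rw [hA, hP, Derivation.leibniz, hD]
    simp only [smul_eq_mul, Multiset.card_cons, Nat.cast_add, Nat.cast_one]
    linear_combination (1 - PowerSeries.C w * PowerSeries.X) * ih + reverseProd s * hgeom

/-- The power sums of the roots and of the critical points of a polynomial satisfy a
convolution recursion. -/
theorem sum_antidiagonal_powerSum {s t : Multiset ℂ}
    (hcard : Multiset.card s = Multiset.card t + 1)
    (hst : derivative (monicProd s) = C (Multiset.card s : ℂ) * monicProd t) (m : ℕ) :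
    ∑ x ∈ Finset.HasAntidiagonal.antidiagonal m,
      powerSum s x.1 * (powerSum s x.2 - powerSum t x.2 - if x.2 = 0 then 1 else 0) =
        m * powerSum s m := by
  -- Reversal turns differentiation into multiplication of the `k`-th coefficient by `n - k`, that
  -- is, into the operator `n - X d/dX`.
  have hQ : (Multiset.card s : PowerSeries ℂ) * reverseProd t =
      powerSumSeries s * reverseProd s := by
    have : (Multiset.card s : PowerSeries ℂ) * reverseProd t =
        (Multiset.card s : PowerSeries ℂ) * reverseProd s -
          PowerSeries.X * PowerSeries.derivative ℂ (reverseProd s) := by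
      ext k
      have hC : (Multiset.card s : PowerSeries ℂ) = PowerSeries.C (Multiset.card s : ℂ) := by simp
      have hXD : PowerSeries.coeff k (PowerSeries.X * PowerSeries.derivative ℂ (reverseProd s)) =
          k * PowerSeries.coeff k (reverseProd s) := by
        rcases k with _ | k
        · simp
        · rw [PowerSeries.coeff_succ_X_mul, PowerSeries.coeff_derivative]; push_cast; ring
      rw [map_sub, hXD, hC, PowerSeries.coeff_C_mul, PowerSeries.coeff_C_mul, coeff_reverseProd,
        coeff_reverseProd]
      have hcoef := fun j => congrArg (fun q : ℂ[X] => q.coeff j) hst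
      simp only [coeff_derivative, coeff_C_mul] at hcoef
      by_cases h : k ≤ Multiset.card t
      · rw [if_pos h, if_pos (by omega), ← hcoef,
          show Multiset.card t - k + 1 = Multiset.card s - k by omega]
        have : ((Multiset.card t - k : ℕ) : ℂ) + 1 = Multiset.card s - k := by
          rw [hcard]; push_cast [h]; ring
        rw [this]; ring
      · rw [if_neg h]
        split_ifs with h'
        -- The one extra coefficient of the longer product is killed by the factor `n - k = 0`.
        · obtain rfl : k = Multiset.card s := by omega
          ring
        · ring
    rw [this, X_mul_derivative_reverseProd]; ring
  -- Logarithmic differentiation of `hQ`; the `1` is the difference of the two cardinalities.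
  have hmain : powerSumSeries s * (powerSumSeries s - powerSumSeries t - 1) =
      PowerSeries.X * PowerSeries.derivative ℂ (powerSumSeries s) := by
    have hD := congrArg (fun f => PowerSeries.X * PowerSeries.derivative ℂ f) hQ
    simp only [Derivation.leibniz, smul_eq_mul, Derivation.map_natCast, mul_zero, add_zero] at hD
    have hs := X_mul_derivative_reverseProd s
    have ht := X_mul_derivative_reverseProd t
    have hc : (Multiset.card s : PowerSeries ℂ) = Multiset.card t + 1 := by
      rw [hcard]; push_cast; rfl
    refine mul_right_cancel₀ (reverseProd_ne_zero s) ?_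
    linear_combination hD + powerSumSeries s * hs - (Multiset.card s : PowerSeries ℂ) * ht
      - (Multiset.card t - powerSumSeries t) * hQ
      + powerSumSeries s * reverseProd s * hc
  have := congrArg (PowerSeries.coeff m) hmain
  rw [PowerSeries.coeff_mul] at this
  simp only [map_sub, PowerSeries.coeff_one] at this
  simp only [powerSumSeries, PowerSeries.coeff_mk] at this
  rw [this]
  rcases m with _ | m
  · simp
  · rw [PowerSeries.coeff_succ_X_mul, PowerSeries.coeff_derivative, PowerSeries.coeff_mk]
    push_cast; ring

/-- A bound on the difference of the power sums of the roots and of the critical points which does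
not depend on the degree. -/
theorem exists_norm_powerSum_sub_le (m : ℕ) :
    ∃ K : ℝ, 0 ≤ K ∧ ∀ s t : Multiset ℂ, Multiset.card s = Multiset.card t + 1 →
      derivative (monicProd s) = C (Multiset.card s : ℂ) * monicProd t →
      (∀ w ∈ s, ‖w‖ ≤ 1) → ‖powerSum s m - powerSum t m‖ ≤ K := by
  induction m using Nat.strong_induction_on with
  | _ m ih =>
    choose! K hK0 hK using ih
    -- The recursion contains the order-`m` difference with coefficient `powerSum s 0 = n`, and all
    -- other terms are `O(n)`, so dividing by `n` leaves no dependence on the degree. The summand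
    -- `m` comes from the right-hand side, the `1`s from the Kronecker delta.
    refine ⟨m + 1 + ∑ k ∈ Finset.range m, (K k + 1), ?_, ?_⟩
    · have : ∀ k ∈ Finset.range m, 0 ≤ K k + 1 := fun k hk => by
        have := hK0 k (Finset.mem_range.1 hk); linarith
      have := Finset.sum_nonneg this
      positivity
    intro s t hcard hst hw
    have hn : (0 : ℝ) < Multiset.card s := by rw [hcard]; positivity
    have hS : ∀ k, ‖powerSum s k‖ ≤ Multiset.card s := by
      intro k
      have h1 := norm_multiset_sum_le (s.map (· ^ k))
      rw [Multiset.map_map] at h1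
      refine h1.trans ?_
      have h2 := Multiset.sum_le_card_nsmul (s.map (norm ∘ (· ^ k))) 1 (by
        intro x hx
        obtain ⟨w, hws, rfl⟩ := Multiset.mem_map.1 hx
        simpa using pow_le_one₀ (norm_nonneg w) (hw w hws))
      simpa using h2
    have hrec := sum_antidiagonal_powerSum hcard hst m
    rw [Finset.Nat.sum_antidiagonal_eq_sum_range_succ
      (fun a b => powerSum s a * (powerSum s b - powerSum t b - if b = 0 then 1 else 0)),
      ← Finset.sum_range_reflect, Finset.sum_range_succ] at hrec
    have hterm : ∀ k ∈ Finset.range m, ‖powerSum s (m + 1 - 1 - k) *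
        (powerSum s (m - (m + 1 - 1 - k)) - powerSum t (m - (m + 1 - 1 - k)) -
          if m - (m + 1 - 1 - k) = 0 then 1 else 0)‖ ≤ Multiset.card s * (K k + 1) := by
      intro k hk
      have hk := Finset.mem_range.1 hk
      rw [show m - (m + 1 - 1 - k) = k by omega, norm_mul]
      refine mul_le_mul (hS _) ?_ (norm_nonneg _) hn.le
      refine (norm_sub_le _ _).trans (add_le_add (hK k hk s t hcard hst hw) ?_)
      split_ifs <;> simp
    have hsum := norm_sum_le_of_le _ hterm
    rw [← Finset.mul_sum] at hsum
    rw [show m - (m + 1 - 1 - m) = m by omega, show m + 1 - 1 - m = 0 by omega,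
      powerSum_zero] at hrec
    have hlast : ‖powerSum s m - powerSum t m - if m = 0 then 1 else 0‖ ≤
        m + ∑ k ∈ Finset.range m, (K k + 1) := by
      refine le_of_mul_le_mul_left ?_ hn
      have hm : ‖(m : ℂ) * powerSum s m‖ ≤ m * Multiset.card s := by
        rw [norm_mul, Complex.norm_natCast]
        exact mul_le_mul_of_nonneg_left (hS m) (Nat.cast_nonneg m)
      calc (Multiset.card s : ℝ) * ‖powerSum s m - powerSum t m - if m = 0 then 1 else 0‖
          = ‖(Multiset.card s : ℂ) * (powerSum s m - powerSum t m - if m = 0 then 1 else 0)‖ := by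
            rw [norm_mul, Complex.norm_natCast]
        _ ≤ _ := by
            rw [← eq_sub_iff_add_eq'] at hrec
            rw [hrec]
            refine (norm_sub_le _ _).trans ((add_le_add hm hsum).trans (le_of_eq ?_))
            ring
    have hite : ‖(if m = 0 then 1 else 0 : ℂ)‖ ≤ 1 := by split_ifs <;> simp
    have := norm_le_norm_sub_add (powerSum s m - powerSum t m) (if m = 0 then 1 else 0)
    linarith

/-! ### Critical points of polynomials with all roots on the unit circle -/

theorem integral_rootMeasure (q : ℂ[X]) (f : ℂ → ℝ) :
    ∫ z, f z ∂(rootMeasure q) = (q.natDegree : ℝ)⁻¹ * (q.roots.map f).sum := by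
  rw [rootMeasure, integral_smul_measure, integral_finsetSum_measure]
  · rw [Finset.sum_multiset_map_count]
    simp [integral_smul_measure, integral_dirac, count_roots]
  · intro z _
    exact (integrable_dirac (by simp)).smul_measure (by simp)

/-- The points `exp (i θ_j)` as a multiset. -/
noncomputable def circlePoints {n : ℕ} (θ : Fin n → ℝ) : Multiset ℂ :=
  Finset.univ.val.map fun j => Complex.exp (Complex.I * θ j)

theorem card_circlePoints {n : ℕ} (θ : Fin n → ℝ) : Multiset.card (circlePoints θ) = n := by
  simp [circlePoints]

theorem monicProd_circlePoints {n : ℕ} (θ : Fin n → ℝ) :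
    monicProd (circlePoints θ) = circlePoly θ := by
  rw [circlePoints, monicProd, circlePoly, Finset.prod, Multiset.map_map]
  rfl

theorem norm_of_mem_circlePoints {n : ℕ} {θ : Fin n → ℝ} {w : ℂ} (hw : w ∈ circlePoints θ) :
    ‖w‖ = 1 := by
  obtain ⟨j, -, rfl⟩ := Multiset.mem_map.1 hw
  rw [mul_comm]
  exact Complex.norm_exp_ofReal_mul_I _

theorem roots_circlePoly {n : ℕ} (θ : Fin n → ℝ) : (circlePoly θ).roots = circlePoints θ := by
  rw [← monicProd_circlePoints]
  exact roots_multiset_prod_X_sub_C _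

theorem natDegree_circlePoly {n : ℕ} (θ : Fin n → ℝ) : (circlePoly θ).natDegree = n := by
  rw [← monicProd_circlePoints, natDegree_monicProd, card_circlePoints]

theorem monic_circlePoly {n : ℕ} (θ : Fin n → ℝ) : (circlePoly θ).Monic :=
  monic_prod_of_monic _ _ fun _ _ => monic_X_sub_C _

theorem natDegree_derivative_circlePoly {n : ℕ} (θ : Fin n → ℝ) :
    (derivative (circlePoly θ)).natDegree = n - 1 := by
  rw [natDegree_derivative, natDegree_circlePoly]

theorem card_roots_derivative_circlePoly {n : ℕ} (θ : Fin n → ℝ) :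
    Multiset.card (derivative (circlePoly θ)).roots = n - 1 := by
  rw [← natDegree_derivative_circlePoly θ]
  exact splits_iff_card_roots.1 (IsAlgClosed.splits _)

theorem leadingCoeff_derivative_circlePoly {n : ℕ} (hn : 0 < n) (θ : Fin n → ℝ) :
    (derivative (circlePoly θ)).leadingCoeff = n := by
  have h := (monic_circlePoly θ).coeff_natDegree
  rw [natDegree_circlePoly] at h
  rw [leadingCoeff, natDegree_derivative_circlePoly, coeff_derivative, Nat.sub_add_cancel hn, h,
    Nat.cast_sub hn]
  simp

theorem derivative_circlePoly_eq {n : ℕ} (hn : 0 < n) (θ : Fin n → ℝ) :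
    derivative (circlePoly θ) = C (n : ℂ) * monicProd (derivative (circlePoly θ)).roots := by
  rw [← leadingCoeff_derivative_circlePoly hn θ]
  exact (IsAlgClosed.splits _).eq_prod_roots

/-- Gauss–Lucas, with the disk as a convex set containing the roots. -/
theorem norm_le_one_of_mem_roots_derivative_circlePoly {n : ℕ} {θ : Fin n → ℝ} {z : ℂ}
    (hz : z ∈ (derivative (circlePoly θ)).roots) : ‖z‖ ≤ 1 := by
  have hn : 0 < n := by
    rcases Nat.eq_zero_or_pos n with rfl | hn
    · simp [circlePoly] at hz
    · exact hn
  have hdeg : 0 < (circlePoly θ).degree := by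
    rw [← natDegree_pos_iff_degree_pos, natDegree_circlePoly]; exact hn
  have hz' : z ∈ (derivative (circlePoly θ)).rootSet ℂ := by
    rw [mem_roots'] at hz
    rw [mem_rootSet, coe_aeval_eq_eval]
    exact hz
  have hsub : (circlePoly θ).rootSet ℂ ⊆ Metric.closedBall 0 1 := by
    intro w hw
    rw [mem_rootSet, coe_aeval_eq_eval] at hw
    have : w ∈ circlePoints θ := by
      rw [← roots_circlePoly, mem_roots']; exact hw
    simpa using (norm_of_mem_circlePoints this).le
  have := convexHull_min hsub (convex_closedBall 0 1)
    (rootSet_derivative_subset_convexHull_rootSet hdeg hz')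
  simpa using this

/-- Both sides are `|p'(0)|`: one through `p'/p` at the origin, where `|p(0)| = 1`, the other
through the factorization of `p'`. -/
theorem norm_sum_exp_neg_eq {n : ℕ} (hn : 0 < n) (θ : Fin n → ℝ) :
    ‖∑ j, Complex.exp (-Complex.I * θ j)‖ =
      n * ((derivative (circlePoly θ)).roots.map norm).prod := by
  have hp0 : ‖(circlePoly θ).eval 0‖ = 1 := by
    rw [circlePoly, eval_prod, norm_prod]
    refine Finset.prod_eq_one fun j _ => ?_
    simp only [eval_sub, eval_X, eval_C, zero_sub, norm_neg]
    rw [mul_comm]; exact Complex.norm_exp_ofReal_mul_I _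
  have hne : (circlePoly θ).eval 0 ≠ 0 := by
    intro h; simp [h] at hp0
  have h1 := (IsAlgClosed.splits (circlePoly θ)).eval_derivative_div_eval_of_ne_zero hne
  have h2 : ‖(derivative (circlePoly θ)).eval 0‖ =
      n * ((derivative (circlePoly θ)).roots.map norm).prod := by
    conv_lhs => rw [derivative_circlePoly_eq hn]
    rw [eval_mul, eval_C, norm_mul, Complex.norm_natCast, monicProd, eval_multiset_prod,
      Multiset.map_map]
    congr 1
    refine (map_multiset_prod (normHom : ℂ →*₀ ℝ) _).trans ?_
    rw [Multiset.map_map]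
    congr 2
    ext z; simp
  rw [← h2]
  have h3 : (derivative (circlePoly θ)).eval 0 =
      (circlePoly θ).eval 0 * -∑ j, Complex.exp (-Complex.I * θ j) := by
    rw [div_eq_iff hne] at h1
    rw [h1, mul_comm, roots_circlePoly, circlePoints, Multiset.map_map]
    congr 1
    change ∑ j, 1 / (0 - Complex.exp (Complex.I * θ j)) = _
    rw [← Finset.sum_neg_distrib]
    refine Finset.sum_congr rfl fun j _ => ?_
    rw [neg_mul, Complex.exp_neg, zero_sub, one_div, inv_neg]
  rw [h3, norm_mul, hp0, norm_neg, one_mul]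

/-- Sums `log x ≤ x - 1` at `x = |z|²`. The product must be nonzero because `Real.log 0 = 0`. -/
theorem sum_one_sub_norm_sq_le (t : Multiset ℂ) (ht : (t.map norm).prod ≠ 0) :
    (t.map fun z => 1 - ‖z‖ ^ 2).sum ≤ -2 * Real.log (t.map norm).prod := by
  induction t using Multiset.induction with
  | empty => simp
  | cons z t ih =>
    simp only [Multiset.map_cons, Multiset.prod_cons, Multiset.sum_cons] at ht ⊢
    have hz : 0 < ‖z‖ := lt_of_le_of_ne (norm_nonneg z) (left_ne_zero_of_mul ht).symm
    rw [Real.log_mul hz.ne' (right_ne_zero_of_mul ht)]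
    have h1 := Real.log_le_sub_one_of_pos (pow_pos hz 2)
    rw [Real.log_pow] at h1
    have h2 := ih (right_ne_zero_of_mul ht)
    push_cast at h1
    linarith

/-! ### Mixed moments and the radial defect -/

/-- The mean of a function over a multiset. -/
noncomputable def multisetMean (t : Multiset ℂ) (g : ℂ → ℂ) : ℂ :=
  (Multiset.card t : ℂ)⁻¹ * (t.map g).sum

/-- The mean of `1 - |z|²` over a multiset. -/
noncomputable def radialDefect (t : Multiset ℂ) : ℝ :=
  (Multiset.card t : ℝ)⁻¹ * (t.map fun z => 1 - ‖z‖ ^ 2).sum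

theorem radialDefect_nonneg {t : Multiset ℂ} (ht : ∀ z ∈ t, ‖z‖ ≤ 1) : 0 ≤ radialDefect t := by
  refine mul_nonneg (by positivity) (Multiset.sum_nonneg fun x hx => ?_)
  obtain ⟨z, hz, rfl⟩ := Multiset.mem_map.1 hx
  have := pow_le_one₀ (n := 2) (norm_nonneg z) (ht z hz)
  linarith

theorem multisetMean_sub (t : Multiset ℂ) (g h : ℂ → ℂ) :
    multisetMean t (fun z => g z - h z) = multisetMean t g - multisetMean t h := by
  simp only [multisetMean, Multiset.sum_map_sub, mul_sub]

theorem norm_multisetMean_le {t : Multiset ℂ} {g : ℂ → ℂ} {u : ℂ → ℝ}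
    (h : ∀ z ∈ t, ‖g z‖ ≤ u z) :
    ‖multisetMean t g‖ ≤ (Multiset.card t : ℝ)⁻¹ * (t.map u).sum := by
  rw [multisetMean, norm_mul, norm_inv, Complex.norm_natCast]
  refine mul_le_mul_of_nonneg_left ?_ (by positivity)
  refine (norm_multiset_sum_le _).trans ?_
  rw [Multiset.map_map]
  exact Multiset.sum_map_le_sum_map _ _ h

/-- The difference is `z ^ k * (|z|^{2b} - 1)`, and Bernoulli's inequality bounds `1 - |z|^{2b}`
linearly. -/
theorem norm_pow_mul_conj_pow_sub_le {z : ℂ} (hz : ‖z‖ ≤ 1) (k b : ℕ) :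
    ‖z ^ (k + b) * (starRingEnd ℂ z) ^ b - z ^ k‖ ≤ b * (1 - ‖z‖ ^ 2) := by
  have h1 : z ^ (k + b) * (starRingEnd ℂ z) ^ b - z ^ k =
      z ^ k * (((‖z‖ ^ 2) ^ b - 1 : ℝ) : ℂ) := by
    rw [pow_add, mul_assoc, ← mul_pow, Complex.mul_conj, Complex.normSq_eq_norm_sq]
    push_cast; ring
  have h0 : 0 ≤ ‖z‖ ^ 2 := by positivity
  have h2 : ‖z‖ ^ 2 ≤ 1 := pow_le_one₀ (norm_nonneg z) hz
  have h3 : (‖z‖ ^ 2) ^ b ≤ 1 := pow_le_one₀ h0 h2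
  have h4 := one_add_mul_le_pow (show (-2 : ℝ) ≤ ‖z‖ ^ 2 - 1 by linarith) b
  rw [add_sub_cancel] at h4
  rw [h1, norm_mul, norm_pow, Complex.norm_real, Real.norm_eq_abs, abs_of_nonpos (by linarith)]
  calc ‖z‖ ^ k * -((‖z‖ ^ 2) ^ b - 1) ≤ 1 * -((‖z‖ ^ 2) ^ b - 1) :=
        mul_le_mul_of_nonneg_right (pow_le_one₀ (norm_nonneg z) hz) (by linarith)
    _ ≤ _ := by linarith

theorem norm_multisetMean_sub_mean_pow_le {t : Multiset ℂ} (ht : ∀ z ∈ t, ‖z‖ ≤ 1) (k b : ℕ) :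
    ‖multisetMean t (fun z => z ^ (k + b) * (starRingEnd ℂ z) ^ b) -
      multisetMean t (fun z => z ^ k)‖ ≤ b * radialDefect t := by
  rw [← multisetMean_sub]
  refine (norm_multisetMean_le fun z hz => norm_pow_mul_conj_pow_sub_le (ht z hz) k b).trans ?_
  rw [Multiset.sum_map_mul_left, radialDefect]
  exact le_of_eq (by ring)

theorem multisetMean_conj (t : Multiset ℂ) (g : ℂ → ℂ) :
    multisetMean t (fun z => starRingEnd ℂ (g z)) = starRingEnd ℂ (multisetMean t g) := by
  rw [multisetMean, multisetMean, map_mul, map_multiset_sum, Multiset.map_map]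
  simp

/-- The mixed moments over a multiset in the closed unit disk are controlled by the radial defect
and the holomorphic moments. -/
theorem norm_multisetMean_mixed_sub_le {t : Multiset ℂ} (ht : ∀ z ∈ t, ‖z‖ ≤ 1) (ht0 : t ≠ 0)
    (a b : ℕ) :
    ‖multisetMean t (fun z => z ^ a * (starRingEnd ℂ z) ^ b) - if a = b then 1 else 0‖ ≤
      (a + b : ℕ) * radialDefect t +
        ‖if a = b then 0 else multisetMean t (fun z => z ^ ((a - b) + (b - a)))‖ := by
  have hD := radialDefect_nonneg ht
  have hcard : (Multiset.card t : ℂ) ≠ 0 := by simpa using ht0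
  have key : ∀ k b : ℕ,
      ‖multisetMean t (fun z => z ^ (k + b) * (starRingEnd ℂ z) ^ b) - if k = 0 then 1 else 0‖ ≤
        b * radialDefect t + ‖if k = 0 then 0 else multisetMean t (fun z => z ^ k)‖ := by
    intro k b
    have h := norm_multisetMean_sub_mean_pow_le ht k b
    split_ifs with hk
    · subst hk
      have h1 : multisetMean t (fun z => z ^ 0) = 1 := by
        simp [multisetMean, hcard]
      rw [h1] at h
      simpa using h
    · rw [sub_zero]
      have := norm_le_norm_sub_add (multisetMean t (fun z => z ^ (k + b) * (starRingEnd ℂ z) ^ b))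
        (multisetMean t (fun z => z ^ k))
      linarith
  -- One of the truncated differences `a - b`, `b - a` vanishes, so their sum is `|a - b|`. The case
  -- `a ≤ b` follows by conjugation.
  rcases le_total b a with hab | hab
  · obtain ⟨k, rfl⟩ := Nat.exists_eq_add_of_le' hab
    have h := key k b
    have hiff : k + b = b ↔ k = 0 := by omega
    simp only [hiff, show k + b - b + (b - (k + b)) = k by omega]
    refine h.trans (add_le_add_left ?_ _)
    exact mul_le_mul_of_nonneg_right (by push_cast; linarith [k.cast_nonneg (α := ℝ)]) hD
  · obtain ⟨k, rfl⟩ := Nat.exists_eq_add_of_le' hab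
    have h := key k a
    have hiff : a = k + a ↔ k = 0 := by omega
    simp only [hiff, show a - (k + a) + (k + a - a) = k by omega]
    have hconj : multisetMean t (fun z => z ^ a * (starRingEnd ℂ z) ^ (k + a)) -
        (if k = 0 then 1 else 0) = starRingEnd ℂ
          (multisetMean t (fun z => z ^ (k + a) * (starRingEnd ℂ z) ^ a) -
            if k = 0 then 1 else 0) := by
      rw [map_sub, ← multisetMean_conj]
      congr 1
      · congr 1; ext z; simp [mul_comm]
      · split_ifs <;> simp
    rw [hconj, RCLike.norm_conj]
    refine h.trans (add_le_add_left ?_ _)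
    exact mul_le_mul_of_nonneg_right (by push_cast; linarith [k.cast_nonneg (α := ℝ)]) hD

/-! ### The uniform law on the circle and approximation on the disk -/

theorem integral_uniformCircle {E : Type*} [NormedAddCommGroup E] [NormedSpace ℝ E]
    {g : ℂ → E} (hg : Continuous g) :
    ∫ z, g z ∂uniformCircle =
      (2 * Real.pi)⁻¹ • ∫ x in (0 : ℝ)..2 * Real.pi, g (Complex.exp (Complex.I * x)) := by
  have hc : Continuous fun t : ℝ => Complex.exp (Complex.I * t) := by fun_prop
  rw [uniformCircle, integral_map_of_stronglyMeasurable hc.measurable hg.stronglyMeasurable,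
    integral_smul_measure, intervalIntegral.integral_of_le Real.two_pi_pos.le,
    integral_Ico_eq_integral_Ioc, ENNReal.toReal_inv, ENNReal.toReal_ofReal Real.two_pi_pos.le]

instance isProbabilityMeasure_uniformCircle : IsProbabilityMeasure uniformCircle := by
  have hc : Continuous fun t : ℝ => Complex.exp (Complex.I * t) := by fun_prop
  refine ⟨?_⟩
  rw [uniformCircle, Measure.map_apply hc.measurable MeasurableSet.univ]
  simp only [Set.preimage_univ, Measure.smul_apply, Measure.restrict_apply MeasurableSet.univ,
    Set.univ_inter, Real.volume_Ico, sub_zero, smul_eq_mul]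
  exact ENNReal.inv_mul_cancel (by simpa using Real.pi_pos) ENNReal.ofReal_ne_top

theorem integral_uniformCircle_mixed (a b : ℕ) :
    ∫ z, z ^ a * (starRingEnd ℂ z) ^ b ∂uniformCircle = if a = b then 1 else 0 := by
  rw [integral_uniformCircle (by fun_prop)]
  have hexp : ∀ x : ℝ, Complex.exp (Complex.I * x) ^ a *
      (starRingEnd ℂ (Complex.exp (Complex.I * x))) ^ b =
        Complex.exp (((a : ℂ) - b) * Complex.I * x) := by
    intro x
    rw [← Complex.exp_conj, ← Complex.exp_nat_mul, ← Complex.exp_nat_mul, ← Complex.exp_add]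
    congr 1
    simp
    ring
  simp_rw [hexp]
  split_ifs with h
  · subst h
    have : (Real.pi : ℂ) ≠ 0 := by exact_mod_cast Real.pi_ne_zero
    simp
    field_simp
  · have hc : ((a : ℂ) - b) * Complex.I ≠ 0 :=
      mul_ne_zero (sub_ne_zero.2 (by exact_mod_cast h)) Complex.I_ne_zero
    rw [integral_exp_mul_complex hc]
    have : Complex.exp (((a : ℂ) - b) * Complex.I * ((2 * Real.pi : ℝ) : ℂ)) = 1 := by
      rw [Complex.exp_eq_one_iff]
      exact ⟨(a : ℤ) - b, by push_cast; ring⟩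
    rw [this]
    simp

theorem ae_norm_le_one_uniformCircle : ∀ᵐ z ∂uniformCircle, ‖z‖ ≤ 1 := by
  have hc : Continuous fun t : ℝ => Complex.exp (Complex.I * t) := by fun_prop
  rw [uniformCircle, ae_map_iff hc.aemeasurable
    (measurableSet_le continuous_norm.measurable measurable_const)]
  refine Filter.Eventually.of_forall fun t => ?_
  rw [mul_comm]; exact (Complex.norm_exp_ofReal_mul_I t).le

/-- Polynomials in `z` and `conj z` are uniformly dense on the closed unit disk. -/
theorem exists_mixed_polynomial_approx {f : ℂ → ℝ} (hf : Continuous f) {ε : ℝ} (hε : 0 < ε) :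
    ∃ c : ℕ × ℕ →₀ ℂ, ∀ z : ℂ, ‖z‖ ≤ 1 →
      ‖(f z : ℂ) - ∑ x ∈ c.support, c x * (z ^ x.1 * (starRingEnd ℂ z) ^ x.2)‖ ≤ ε := by
  set K : Set ℂ := Metric.closedBall 0 1
  have : CompactSpace K := isCompact_iff_compactSpace.1 (isCompact_closedBall 0 1)
  let F : C(K, ℂ) := ⟨fun z => (f z : ℂ), by fun_prop⟩
  let m : ℕ × ℕ → C(K, ℂ) := fun x =>
    (toContinuousMapOnAlgHom K X) ^ x.1 * (star (toContinuousMapOnAlgHom K X)) ^ x.2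
  have hF : F ∈ (polynomialFunctions K).starClosure.topologicalClosure := by
    rw [polynomialFunctions.starClosure_topologicalClosure]; trivial
  rw [← SetLike.mem_coe, StarSubalgebra.topologicalClosure_coe, Metric.mem_closure_iff] at hF
  obtain ⟨g, hg, hgF⟩ := hF ε hε
  -- The star subalgebra generated by `X` is the linear span of the monomials in `X` and `star X`.
  have hspan : g ∈ Submodule.span ℂ (Set.range m) := by
    rw [polynomialFunctions.starClosure_eq_adjoin_X, SetLike.mem_coe,
      ← StarSubalgebra.mem_toSubalgebra, StarAlgebra.adjoin_toSubalgebra,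
      ← Subalgebra.mem_toSubmodule, Algebra.adjoin_eq_span] at hg
    refine Submodule.span_mono ?_ hg
    intro u hu
    rw [Set.star_singleton, Set.singleton_union, SetLike.mem_coe,
      Submonoid.mem_closure_pair] at hu
    obtain ⟨a, b, rfl⟩ := hu
    exact ⟨(a, b), rfl⟩
  obtain ⟨c, rfl⟩ := (Finsupp.mem_span_range_iff_exists_finsupp).1 hspan
  refine ⟨c, fun z hz => ?_⟩
  have hz' : z ∈ K := by simpa [K] using hz
  have := (ContinuousMap.dist_apply_le_dist (f := F) (g := c.sum fun i a => a • m i)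
    (⟨z, hz'⟩ : K)).trans hgF.le
  rw [dist_eq_norm] at this
  convert! this using 3
  simp [Finsupp.sum, m]

/-! ### Convergence in probability -/

section Probability

variable {Ω : ℕ → Type*} [∀ n, MeasurableSpace (Ω n)] {P : ∀ n, Measure (Ω n)}

theorem TendstoInProb.of_norm_le {X Y Z : ∀ n, Ω n → ℂ} (hX : TendstoInProb P X 0)
    (hY : TendstoInProb P Y 0) (h : ∀ᶠ n in atTop, ∀ ω, ‖Z n ω‖ ≤ ‖X n ω‖ + ‖Y n ω‖) :
    TendstoInProb P Z 0 := by
  intro ε hε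
  have hsum := (hX (ε / 2) (by positivity)).add (hY (ε / 2) (by positivity))
  rw [add_zero] at hsum
  refine tendsto_of_tendsto_of_tendsto_of_le_of_le' tendsto_const_nhds hsum
    (Eventually.of_forall fun _ => zero_le) ?_
  filter_upwards [h] with n hn
  refine (measure_mono fun ω hω => ?_).trans (measure_union_le _ _)
  simp only [Set.mem_ofPred_eq, Set.mem_union, sub_zero] at hω ⊢
  by_contra! hcon
  linarith [hn ω, hcon.1, hcon.2]

theorem TendstoInProb.of_tendsto {r : ℕ → ℂ} (hr : Tendsto r atTop (𝓝 0)) :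
    TendstoInProb P (fun n _ => r n) 0 := by
  intro ε hε
  refine tendsto_const_nhds.congr' ?_
  filter_upwards [(Metric.tendsto_nhds.1 hr) ε hε] with n hn
  rw [dist_eq_norm] at hn
  simp [not_lt.2 (by simpa using hn.le : ‖r n‖ ≤ ε)]

theorem TendstoInProb.const_mul {X : ∀ n, Ω n → ℂ} (hX : TendstoInProb P X 0) (c : ℂ) :
    TendstoInProb P (fun n ω => c * X n ω) 0 := by
  intro ε hε
  -- The added `1` keeps the threshold well defined when `c = 0`.
  have hc : 0 < ‖c‖ + 1 := by positivity
  refine tendsto_of_tendsto_of_tendsto_of_le_of_le tendsto_const_nhds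
    (hX (ε / (‖c‖ + 1)) (by positivity)) (fun _ => zero_le) fun n => measure_mono fun ω hω => ?_
  simp only [Set.mem_ofPred_eq, sub_zero, norm_mul] at hω ⊢
  rw [div_lt_iff₀ hc]
  nlinarith [norm_nonneg (X n ω)]

theorem TendstoInProb.finset_sum {ι : Type*} (s : Finset ι) {X : ι → ∀ n, Ω n → ℂ}
    (hX : ∀ i ∈ s, TendstoInProb P (X i) 0) :
    TendstoInProb P (fun n ω => ∑ i ∈ s, X i n ω) 0 := by
  classical
  induction s using Finset.induction_on with
  | empty => simpa using TendstoInProb.of_tendsto (P := P) (r := fun _ => 0) tendsto_const_nhds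
  | insert i s hi ih =>
    refine (hX i (by simp)).of_norm_le (ih fun j hj => hX j (by simp [hj]))
      (Eventually.of_forall fun n ω => ?_)
    rw [Finset.sum_insert hi]
    exact norm_add_le _ _

theorem tendsto_inv_mul_log_div {δ : ℝ} (hδ : 0 < δ) :
    Tendsto (fun n : ℕ => ((n - 1 : ℕ) : ℝ)⁻¹ * (-2 * Real.log (δ / n))) atTop (𝓝 0) := by
  have h1 := tendsto_natCast_div_add_atTop (𝕜 := ℝ) (-1)
  have h2 : Tendsto (fun n : ℕ => Real.log n / n) atTop (𝓝 0) :=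
    (Real.isLittleO_log_id_atTop.tendsto_div_nhds_zero).comp tendsto_natCast_atTop_atTop
  have h3 : Tendsto (fun n : ℕ => Real.log δ / n) atTop (𝓝 0) :=
    tendsto_const_div_atTop_nhds_zero_nat _
  have h4 := (h1.mul ((h2.sub h3).const_mul 2))
  simp only [sub_zero, mul_zero] at h4
  refine h4.congr' ?_
  filter_upwards [eventually_ge_atTop 2] with n hn
  have hn0 : (n : ℝ) ≠ 0 := by positivity
  have hn1 : (n : ℝ) - 1 ≠ 0 := by
    have : (2 : ℝ) ≤ n := by exact_mod_cast hn
    linarith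
  rw [Real.log_div hδ.ne' hn0, Nat.cast_sub (by omega), Nat.cast_one, ← sub_eq_add_neg]
  field_simp
  ring

theorem radialDefect_critical_le {n : ℕ} (hn : 0 < n) (θ : Fin n → ℝ) {δ : ℝ} (hδ : 0 < δ)
    (h : δ ≤ ‖∑ j, Complex.exp (-Complex.I * θ j)‖) :
    radialDefect (derivative (circlePoly θ)).roots ≤
      ((n - 1 : ℕ) : ℝ)⁻¹ * (-2 * Real.log (δ / n)) := by
  have hn' : (0 : ℝ) < n := by exact_mod_cast hn
  rw [norm_sum_exp_neg_eq hn, mul_comm, ← div_le_iff₀ hn'] at h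
  have h0 : 0 < δ / n := by positivity
  rw [radialDefect, card_roots_derivative_circlePoly]
  refine mul_le_mul_of_nonneg_left ?_ (by positivity)
  have h1 := sum_one_sub_norm_sq_le _ (h0.trans_le h).ne'
  have h2 := Real.log_le_log h0 h
  linarith

/-- The critical points concentrate near the unit circle. -/
theorem tendstoInProb_radialDefect (θ : ∀ n : ℕ, Fin n → Ω n → ℝ)
    (h1 : AntiConcentratesAtZero P
      (fun n ω => ∑ j : Fin n, Complex.exp (-Complex.I * θ n j ω))) :
    TendstoInProb P (fun n ω =>
      (radialDefect (derivative (circlePoly fun j => θ n j ω)).roots : ℂ)) 0 := by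
  intro ε hε
  rw [ENNReal.tendsto_nhds_zero]
  intro η hη
  -- With `δ` fixed, the deterministic bound `2 log (n/δ) / (n - 1)` eventually drops below `ε`, so
  -- the bad event forces `|∑ e^{-iθ_j}| ≤ δ`.
  obtain ⟨δ, hδη, hδ⟩ := ((h1.eventually_lt_const hη).and self_mem_nhdsWithin).exists
  have hδ : 0 < δ := hδ
  filter_upwards [eventually_lt_of_limsup_lt hδη, eventually_gt_atTop 0,
    (tendsto_inv_mul_log_div hδ).eventually_lt_const hε] with n hn hn0 hnε
  refine (measure_mono fun ω hω => ?_).trans hn.le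
  simp only [Set.mem_ofPred_eq, sub_zero, Complex.norm_real, Real.norm_eq_abs] at hω ⊢
  rw [abs_of_nonneg (radialDefect_nonneg fun z hz =>
    norm_le_one_of_mem_roots_derivative_circlePoly hz)] at hω
  by_contra! hcon
  linarith [radialDefect_critical_le hn0 (fun j => θ n j ω) hδ hcon.le]

/-- The holomorphic moments of the critical points tend to zero in probability. -/
theorem tendstoInProb_multisetMean_pow (θ : ∀ n : ℕ, Fin n → Ω n → ℝ)
    (h3 : ∀ m : ℕ, 1 ≤ m → TendstoInProb P
      (fun n ω => (1 / (n : ℂ)) * ∑ j : Fin n, Complex.exp (Complex.I * θ n j ω * m)) 0)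
    {m : ℕ} (hm : 1 ≤ m) :
    TendstoInProb P (fun n ω =>
      multisetMean (derivative (circlePoly fun j => θ n j ω)).roots (fun z => z ^ m)) 0 := by
  obtain ⟨K, hK0, hK⟩ := exists_norm_powerSum_sub_le m
  -- The factor `2` comes from `1 / (n - 1) ≤ 2 / n` for `n ≥ 2`.
  have hr : Tendsto (fun n : ℕ => ((2 * K / n : ℝ) : ℂ)) atTop (𝓝 0) := by
    rw [← Complex.ofReal_zero]
    exact (Complex.continuous_ofReal.tendsto 0).comp (tendsto_const_div_atTop_nhds_zero_nat _)
  refine ((h3 m hm).const_mul 2).of_norm_le (TendstoInProb.of_tendsto hr) ?_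
  filter_upwards [eventually_ge_atTop 2] with n hn ω
  have hn0 : 0 < n := by omega
  set s := circlePoints (fun j => θ n j ω)
  set t := (derivative (circlePoly fun j => θ n j ω)).roots
  have hct : Multiset.card t = n - 1 := card_roots_derivative_circlePoly _
  have hcs : Multiset.card s = n := card_circlePoints _
  have hst := hK s t (by omega)
    (by rw [hcs, monicProd_circlePoints]; exact derivative_circlePoly_eq hn0 _)
    (fun w hw => (norm_of_mem_circlePoints hw).le)
  have hs : powerSum s m = ∑ j : Fin n, Complex.exp (Complex.I * θ n j ω * m) := by
    rw [powerSum, show s = circlePoints (fun j => θ n j ω) from rfl, circlePoints,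
      Multiset.map_map]
    refine Finset.sum_congr rfl fun j _ => ?_
    rw [Function.comp_apply, ← Complex.exp_nat_mul, mul_comm]
  rw [← hs]
  have ht : multisetMean t (fun z => z ^ m) = ((n - 1 : ℕ) : ℂ)⁻¹ * powerSum t m := by
    rw [multisetMean, hct]; rfl
  have hn2 : (2 : ℝ) ≤ n := by exact_mod_cast hn
  have hinv : ((n - 1 : ℕ) : ℝ)⁻¹ ≤ 2 / n := by
    rw [Nat.cast_sub hn0, Nat.cast_one, inv_eq_one_div, div_le_div_iff₀ (by linarith) (by linarith)]
    linarith
  have htri : ‖powerSum t m‖ ≤ ‖powerSum s m‖ + K := by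
    have := norm_le_norm_add_norm_sub' (powerSum t m) (powerSum s m)
    rw [norm_sub_rev] at this
    linarith
  rw [ht, norm_mul, norm_inv, Complex.norm_natCast, Complex.norm_real, Real.norm_of_nonneg
    (by positivity)]
  calc ((n - 1 : ℕ) : ℝ)⁻¹ * ‖powerSum t m‖ ≤ 2 / n * (‖powerSum s m‖ + K) :=
        mul_le_mul hinv htri (norm_nonneg _) (by positivity)
    _ = _ := by
        simp only [norm_mul, norm_div, norm_one, Complex.norm_natCast, Complex.norm_ofNat]
        ring

theorem tendstoInProb_multisetMean_mixed (θ : ∀ n : ℕ, Fin n → Ω n → ℝ)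
    (h1 : AntiConcentratesAtZero P
      (fun n ω => ∑ j : Fin n, Complex.exp (-Complex.I * θ n j ω)))
    (h3 : ∀ m : ℕ, 1 ≤ m → TendstoInProb P
      (fun n ω => (1 / (n : ℂ)) * ∑ j : Fin n, Complex.exp (Complex.I * θ n j ω * m)) 0)
    (a b : ℕ) :
    TendstoInProb P (fun n ω =>
      multisetMean (derivative (circlePoly fun j => θ n j ω)).roots
        (fun z => z ^ a * (starRingEnd ℂ z) ^ b) -
          ∫ z, z ^ a * (starRingEnd ℂ z) ^ b ∂uniformCircle) 0 := by
  have hM : TendstoInProb P (fun n ω => if a = b then 0 else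
      multisetMean (derivative (circlePoly fun j => θ n j ω)).roots
        (fun z => z ^ ((a - b) + (b - a)))) 0 := by
    split_ifs with h
    · exact TendstoInProb.of_tendsto tendsto_const_nhds
    · exact tendstoInProb_multisetMean_pow θ h3 (by omega)
  refine ((tendstoInProb_radialDefect θ h1).const_mul (a + b : ℕ)).of_norm_le hM ?_
  filter_upwards [eventually_ge_atTop 2] with n hn ω
  have ht0 : (derivative (circlePoly fun j => θ n j ω)).roots ≠ 0 := by
    rw [← Multiset.card_pos, card_roots_derivative_circlePoly]; omega
  have hle := fun z (hz : z ∈ (derivative (circlePoly fun j => θ n j ω)).roots) =>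
    norm_le_one_of_mem_roots_derivative_circlePoly hz
  rw [integral_uniformCircle_mixed, norm_mul, Complex.norm_natCast, Complex.norm_real,
    Real.norm_of_nonneg (radialDefect_nonneg hle)]
  exact norm_multisetMean_mixed_sub_le hle ht0 a b

/-! ### From mixed moments to continuous test functions -/

theorem ofReal_integral_criticalMeasure {n : ℕ} (θ : Fin n → ℝ) (f : ℂ → ℝ) :
    ((∫ z, f z ∂(criticalMeasure (circlePoly θ)) : ℝ) : ℂ) =
      multisetMean (derivative (circlePoly θ)).roots (fun z => (f z : ℂ)) := by
  rw [criticalMeasure, integral_rootMeasure, multisetMean, card_roots_derivative_circlePoly,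
    natDegree_derivative_circlePoly]
  push_cast
  congr 1
  exact (map_multiset_sum Complex.ofRealHom _).trans (by rw [Multiset.map_map]; rfl)

theorem norm_multisetMean_le_of_forall {t : Multiset ℂ} {g : ℂ → ℂ} {ε : ℝ} (hε : 0 ≤ ε)
    (h : ∀ z ∈ t, ‖g z‖ ≤ ε) : ‖multisetMean t g‖ ≤ ε := by
  refine (norm_multisetMean_le h).trans ?_
  rw [Multiset.map_const', Multiset.sum_replicate, nsmul_eq_mul, ← mul_assoc]
  exact mul_le_of_le_one_left hε (inv_mul_le_one)

theorem multisetMean_sum {ι : Type*} (t : Multiset ℂ) (s : Finset ι) (c : ι → ℂ)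
    (g : ι → ℂ → ℂ) :
    multisetMean t (fun z => ∑ i ∈ s, c i * g i z) = ∑ i ∈ s, c i * multisetMean t (g i) := by
  have h : (t.map fun z => ∑ i ∈ s, c i * g i z).sum = ∑ i ∈ s, c i * (t.map (g i)).sum := by
    induction t using Multiset.induction with
    | empty => simp
    | cons z t ih => simp [ih, mul_add, Finset.sum_add_distrib]
  rw [multisetMean, h, Finset.mul_sum]
  exact Finset.sum_congr rfl fun i _ => mul_left_comm _ _ _

theorem integrable_uniformCircle {g : ℂ → ℂ} (hg : Continuous g) : Integrable g uniformCircle := by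
  obtain ⟨C, hC⟩ := (isCompact_closedBall (0 : ℂ) 1).exists_bound_of_continuousOn hg.continuousOn
  refine Integrable.of_bound hg.aestronglyMeasurable C ?_
  filter_upwards [ae_norm_le_one_uniformCircle] with z hz
  exact hC z (by simpa using hz)

end Probability

theorem theorem2p4 {Ω : ℕ → Type*} [∀ n, MeasurableSpace (Ω n)]
    (P : ∀ n, Measure (Ω n)) [∀ n, IsProbabilityMeasure (P n)]
    (θ : ∀ n : ℕ, Fin n → Ω n → ℝ)
    (hmeas : ∀ n j, Measurable (θ n j))
    (hrange : ∀ n j ω, θ n j ω ∈ Set.Ico 0 (2 * Real.pi))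
    (h1 : AntiConcentratesAtZero P
      (fun n ω => ∑ j : Fin n, Complex.exp (-Complex.I * θ n j ω)))
    (h2 : ∀ᵐ z : ℂ ∂(volume.restrict (Metric.ball (0 : ℂ) 1)), AntiConcentratesAtZero P
      (fun n ω => ∑ m ∈ Finset.range (⌊Real.log n ^ 2⌋₊ + 1),
        z ^ m * ∑ j : Fin n, Complex.exp (-Complex.I * θ n j ω * (m + 1))))
    (h3 : ∀ m : ℕ, 1 ≤ m → TendstoInProb P
      (fun n ω => (1 / (n : ℂ)) * ∑ j : Fin n, Complex.exp (Complex.I * θ n j ω * m)) 0) :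
    TendstoWeaklyInProb P
      (fun n ω => criticalMeasure (circlePoly (fun j => θ n j ω))) uniformCircle := by
  intro f ε hε
  obtain ⟨c, hc⟩ := exists_mixed_polynomial_approx f.continuous (show 0 < ε / 3 by positivity)
  have hsum := TendstoInProb.finset_sum c.support fun x _ =>
    (tendstoInProb_multisetMean_mixed θ h1 h3 x.1 x.2).const_mul (c x)
  refine tendsto_of_tendsto_of_tendsto_of_le_of_le tendsto_const_nhds
    (hsum (ε / 3) (by positivity)) (fun _ => zero_le) fun n => measure_mono fun ω hω => ?_
  simp only [Set.mem_ofPred_eq, sub_zero] at hω ⊢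
  -- Three errors of at most `ε / 3`: replacing `f` by `g` under each of the two measures, and
  -- comparing the integrals of `g`. Together they contradict a deviation exceeding `ε`.
  by_contra! hcon
  set t := (derivative (circlePoly fun j => θ n j ω)).roots
  set g : ℂ → ℂ := fun z => ∑ x ∈ c.support, c x * (z ^ x.1 * (starRingEnd ℂ z) ^ x.2)
  have hgc : Continuous g := by fun_prop
  have hA : ‖multisetMean t (fun z => (f z : ℂ)) - multisetMean t g‖ ≤ ε / 3 := by
    rw [← multisetMean_sub]
    exact norm_multisetMean_le_of_forall (by positivity) fun z hz =>
      hc z (norm_le_one_of_mem_roots_derivative_circlePoly hz)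
  have hB : ‖∫ z, (f z : ℂ) ∂uniformCircle - ∫ z, g z ∂uniformCircle‖ ≤ ε / 3 := by
    rw [← integral_sub (integrable_uniformCircle (by fun_prop)) (integrable_uniformCircle hgc)]
    have := norm_integral_le_of_norm_le_const (μ := uniformCircle)
      (f := fun z => (f z : ℂ) - g z) (C := ε / 3)
      (by filter_upwards [ae_norm_le_one_uniformCircle] with z hz using hc z hz)
    simpa using this
  have hC : ‖multisetMean t g - ∫ z, g z ∂uniformCircle‖ ≤ ε / 3 := by
    refine (le_of_eq ?_).trans hcon
    congr 1
    rw [multisetMean_sum, integral_finsetSum _ fun x _ => integrable_uniformCircle (by fun_prop)]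
    simp only [integral_const_mul, mul_sub, Finset.sum_sub_distrib]
  have hD : (((∫ z, f z ∂(criticalMeasure (circlePoly fun j => θ n j ω))) -
      ∫ z, f z ∂uniformCircle : ℝ) : ℂ) =
        (multisetMean t (fun z => (f z : ℂ)) - multisetMean t g) +
          (multisetMean t g - ∫ z, g z ∂uniformCircle) -
          (∫ z, (f z : ℂ) ∂uniformCircle - ∫ z, g z ∂uniformCircle) := by
    rw [Complex.ofReal_sub, ofReal_integral_criticalMeasure, ← integral_complex_ofReal]
    ring
  rw [← Real.norm_eq_abs, ← Complex.norm_real, hD] at hω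
  have h4 := norm_sub_le ((multisetMean t (fun z => (f z : ℂ)) - multisetMean t g) +
          (multisetMean t g - ∫ z, g z ∂uniformCircle))
          (∫ z, (f z : ℂ) ∂uniformCircle - ∫ z, g z ∂uniformCircle)
  have h5 := norm_add_le (multisetMean t (fun z => (f z : ℂ)) - multisetMean t g)
          (multisetMean t g - ∫ z, g z ∂uniformCircle)
  linarith
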